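/- Let $X$ be a complex Banach space, $T$ a bounded linear operator on $X$, and let $T^*$ on the topological dual $X^*$ be its adjoint, $T^*f=f\circ T$. Write $\mathcal N(S)$ and $\mathcal R(S)$ for the kernel and the range of an operator $S$. Dimensions and codimensions take values in $\mathbb N\cup\{\infty\}$ (all infinite dimensions are identified), and $\inf\emptyset=\infty$. Let $\mathrm{Red}(T)$ be the set of pairs $(M,N)$ of closed $T$-invariant subspaces with $X=M\oplus N$; for such a pair let $T_M$, $T_N$ be the restrictions of $T$ to operators on $M$ and on $N$. A bounded operator $S$ is *semi-regular* if $\mathcal R(S)$ is closed and $\mathcal N(S)\subset\bigcap_{n}\mathcal R(S^n)$; *quasi-nilpotent* if $\sigma(S)\subset\{0\}$ (so the operator on the zero space is included); *semi-Fredholm* if either $\mathcal R(S)$ is closed and $\dim\mathcal N(S)<\infty$, or $\operatorname{codim}\mathcal R(S)<\infty$, and then its index is $\operatorname{ind}(S)=\dim\mathcal N(S)-\operatorname{codim}\mathcal R(S)\in\mathbb Z\cup\{\pm\infty\}$. The operator $T$ is *pseudo-Fredholm* if there is $(M,N)\in\mathrm{Red}(T)$ with $T_M$ semi-regular and $T_N$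 quasi-nilpotent. In this case put $$\alpha(T)=\dim\mathcal N(T_M),\qquad \beta(T)=\operatorname{codim}_M\mathcal R(T_M),$$ $$p(T)=\inf\{n\in\mathbb N:\mathcal N(T_M^n)=\mathcal N(T_M^m)\ \text{for all } m\ge n\},\qquad q(T)=\inf\{n\in\mathbb N:\mathcal R(T_M^n)=\mathcal R(T_M^m)\ \text{for all } m\ge n\}.$$ The operator $T$ is *pseudo semi-B-Fredholm* if there is $(M,N)\in\mathrm{Red}(T)$ with $T_M$ semi-Fredholm and $T_N$ quasi-nilpotent; in this case put $\operatorname{ind}(T)=\operatorname{ind}(T_M)$. **Theorem.** The quantities $\alpha(T),\beta(T),p(T),q(T)$ of a pseudo-Fredholm operator, and $\operatorname{ind}(T)$ of a pseudo semi-B-Fredholm operator, do not depend on the choice of the pair $(M,N)$ in their definition. If $T$ is pseudo-Fredholm, then $T^*$ is pseudo-Fredholm and $$\alpha(T)=\beta(T^*),\qquad \beta(T)=\alpha(T^*),\qquad p(T)=q(T^*),\qquad q(T)=p(T^*).$$ If $T$ is pseudo semi-B-Fredholm, then $T^*$ is pseudo semi-B-Fredholm and $\operatorname{ind}(T)=-\operatorname{ind}(T^*)$.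 -/

import Mathlib

open scoped ENNReal

noncomputable section

namespace PseudoFredholm

variable {X : Type*} [NormedAddCommGroup X] [NormedSpace ℂ X]

/-- The dimension of the kernel of `S`, with all infinite cardinals identified with `∞`. -/
def kerDim (S : X →L[ℂ] X) : ℕ∞ :=
  Cardinal.toENat (Module.rank ℂ (LinearMap.ker S.toLinearMap))

/-- The codimension of the range of `S`, with all infinite cardinals identified with `∞`. -/
def rangeCodim (S : X →L[ℂ] X) : ℕ∞ :=
  Cardinal.toENat (Module.rank ℂ (X ⧸ LinearMap.range S.toLinearMap))

/-- The least `n` with `ker Sⁿ = ker Sᵐ` for all `m ≥ n` (`∞` if there is none). -/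
def operatorAscent (S : X →L[ℂ] X) : ℕ∞ :=
  ⨅ n ∈ {n : ℕ | ∀ m ≥ n,
    LinearMap.ker (S ^ n).toLinearMap = LinearMap.ker (S ^ m).toLinearMap}, (n : ℕ∞)

/-- The least `n` with `range Sⁿ = range Sᵐ` for all `m ≥ n` (`∞` if there is none). -/
def operatorDescent (S : X →L[ℂ] X) : ℕ∞ :=
  ⨅ n ∈ {n : ℕ | ∀ m ≥ n,
    LinearMap.range (S ^ n).toLinearMap = LinearMap.range (S ^ m).toLinearMap}, (n : ℕ∞)

/-- Closed range and kernel contained in the range of every power. -/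
def IsSemiRegular (S : X →L[ℂ] X) : Prop :=
  IsClosed (Set.range S) ∧
    LinearMap.ker S.toLinearMap ≤ ⨅ n : ℕ, LinearMap.range (S ^ n).toLinearMap

/-- Quasi-nilpotent: no point other than `0` in the spectrum.  On a nonzero Banach space this says
that the spectrum is `{0}`; the operator on the zero space (with empty spectrum) is included, since
trivial summands are allowed in the decompositions below. -/
def IsQuasiNilpotent (S : X →L[ℂ] X) : Prop :=
  spectrum ℂ S ⊆ {0}

def IsUpperSemiFredholm (S : X →L[ℂ] X) : Prop :=
  IsClosed (Set.range S) ∧ kerDim S < ⊤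

def IsLowerSemiFredholm (S : X →L[ℂ] X) : Prop :=
  rangeCodim S < ⊤

def IsSemiFredholm (S : X →L[ℂ] X) : Prop :=
  IsUpperSemiFredholm S ∨ IsLowerSemiFredholm S

/-- The index `dim ker S - codim range S` of a semi-Fredholm operator, in `ℤ ∪ {-∞, +∞}`, regarded
as part of the extended reals.  (At most one of the two terms is infinite.) -/
def semiFredholmIndex (S : X →L[ℂ] X) : EReal :=
  ((kerDim S : ℝ≥0∞) : EReal) - ((rangeCodim S : ℝ≥0∞) : EReal)

/-- A pair `(M, N)` of closed `T`-invariant subspaces with `X = M ⊕ N`. -/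
structure Red (T : X →L[ℂ] X) where
  M : Submodule ℂ X
  N : Submodule ℂ X
  isClosed_M : IsClosed (M : Set X)
  isClosed_N : IsClosed (N : Set X)
  mapsTo_M : ∀ x ∈ M, T x ∈ M
  mapsTo_N : ∀ x ∈ N, T x ∈ N
  isCompl : IsCompl M N

/-- The restriction of `T` to `M`, as an operator on `M`. -/
def Red.onM {T : X →L[ℂ] X} (d : Red T) : d.M →L[ℂ] d.M :=
  T.restrict d.mapsTo_M

/-- The restriction of `T` to `N`, as an operator on `N`. -/
def Red.onN {T : X →L[ℂ] X} (d : Red T) : d.N →L[ℂ] d.N :=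
  T.restrict d.mapsTo_N

/-- `(M, N)` is a generalized Kato decomposition of `T`. -/
def Red.IsGKD {T : X →L[ℂ] X} (d : Red T) : Prop :=
  IsSemiRegular d.onM ∧ IsQuasiNilpotent d.onN

/-- `T` restricted to `M` is semi-Fredholm and `T` restricted to `N` is quasi-nilpotent. -/
def Red.IsSemiFredholmQuasiNilpotent {T : X →L[ℂ] X} (d : Red T) : Prop :=
  IsSemiFredholm d.onM ∧ IsQuasiNilpotent d.onN

def IsPseudoFredholm (T : X →L[ℂ] X) : Prop :=
  ∃ d : Red T, d.IsGKD

def IsPseudoSemiBFredholm (T : X →L[ℂ] X) : Prop :=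
  ∃ d : Red T, d.IsSemiFredholmQuasiNilpotent

/-- The nullity `α(T)`, read off from some generalized Kato decomposition. -/
def nullity (T : X →L[ℂ] X) (hT : IsPseudoFredholm T) : ℕ∞ :=
  kerDim hT.choose.onM

/-- The deficiency `β(T)`, read off from some generalized Kato decomposition. -/
def deficiency (T : X →L[ℂ] X) (hT : IsPseudoFredholm T) : ℕ∞ :=
  rangeCodim hT.choose.onM

/-- The ascent `p(T)`, read off from some generalized Kato decomposition. -/
def ascent (T : X →L[ℂ] X) (hT : IsPseudoFredholm T) : ℕ∞ :=
  operatorAscent hT.choose.onM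

/-- The descent `q(T)`, read off from some generalized Kato decomposition. -/
def descent (T : X →L[ℂ] X) (hT : IsPseudoFredholm T) : ℕ∞ :=
  operatorDescent hT.choose.onM

/-- The index of a pseudo semi-B-Fredholm operator, read off from some decomposition into a
semi-Fredholm and a quasi-nilpotent operator. -/
def index (T : X →L[ℂ] X) (hT : IsPseudoSemiBFredholm T) : EReal :=
  semiFredholmIndex hT.choose.onM

/-- The Banach space adjoint `f ↦ f ∘ T` on the topological dual. -/
def adjoint (T : X →L[ℂ] X) : StrongDual ℂ X →L[ℂ] StrongDual ℂ X :=
  ContinuousLinearMap.precomp ℂ T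

end PseudoFredholm

end

/-!
The decomposition of `T` enters the invariants only through data of `T` itself.

*Nullity.*  If `T_M` is semi-regular, then for a vector `x` of `ker T_M` there are vectors `u n` of
`M` with `T_Mⁿ (u n) = x` and `‖u n‖ ≤ Cⁿ ‖x‖`: the kernels of all powers lie in the range, and the
open mapping theorem bounds the preimages (`IsSemiRegular.exists_backward_orbit`).  If `T_{N'}` is
quasi-nilpotent for another decomposition, `‖T_{N'}ⁿ‖` decays faster than any geometric sequence,
and this forces the component of `x` in `N'` to vanish.  So
`ker T ∩ M = ker T ∩ M'` (`Red.mem_M_of_ker`, `Red.kerDim_onM_eq`).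

*Duality.*  The adjoint has the decomposition `X* = N^⊥ ⊕ M^⊥` (`Red.dual`), whose summands are
similar to the adjoints of `T_M` and `T_N` (`Red.dualEquiv`).  For an operator `S` with closed range,
`ker S* = (range S)^⊥` and `range S* = (ker S)^⊥`, so passing to the adjoint exchanges `dim ker` and
`codim range`; it also preserves semi-regularity and quasi-nilpotence.  Thus the nullity of `T*` is
the deficiency of `T`, and the latter is independent of the decomposition as well.

*Ascent and descent.*  For a semi-regular operator these are `0` or `∞`, according to whether the
kernel, respectively the cokernel, is trivial
(`IsSemiRegular.operatorAscent_eq`, `IsSemiRegular.operatorDescent_eq`).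

*Index.*  If `T_M` is upper semi-Fredholm, then for all small `c ≠ 0` the operator `T_N - c` is
invertible and `ind (T - c) = ind (T_M - c) = ind T_M`
(`Red.eventually_semiFredholmIndex_sub_smul`).  The second equality is the stability of the index
(`IsUpperSemiFredholm.eventually_sub_smul`): on a closed complement `Z` of `ker S` the operators
`S - c` are bounded below, the codimension of `(S - c) Z` is constant along a connected family of
operators bounded below (`edim_eq_of_preconnectedSpace`), and it differs from the codimension of
`range (S - c)` by an Euler characteristic (`edim_ker_add_edim_quotient_map`).  The index is
therefore that of `T - c`, a quantity of `T` alone.  If `T_M` is lower semi-Fredholm, the same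
applies to `T*`, and the two cases are consistent because `T* - c` is the adjoint of `T - c`
(`Red.semiFredholmIndex_onM_eq_of_upper_of_lower`).
-/

noncomputable section

namespace PseudoFredholm

/-! ### Dimensions in `ℕ∞` -/

/-- The dimension of a complex vector space, with all infinite cardinals identified with `∞`. -/
def edim (V : Type*) [AddCommGroup V] [Module ℂ V] : ℕ∞ :=
  Cardinal.toENat (Module.rank ℂ V)

section edim

variable {V W : Type*} [AddCommGroup V] [Module ℂ V] [AddCommGroup W] [Module ℂ W]

theorem edim_congr (e : V ≃ₗ[ℂ] W) : edim V = edim W := by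
  have h := congrArg Cardinal.toENat e.lift_rank_eq
  simpa [edim, Cardinal.toENat_lift] using h

theorem edim_lt_top : edim V < ⊤ ↔ FiniteDimensional ℂ V := by
  rw [edim, Cardinal.toENat_lt_top, Module.rank_lt_aleph0_iff]

theorem edim_of_finiteDimensional [FiniteDimensional ℂ V] :
    edim V = Module.finrank ℂ V := by
  rw [edim, ← Module.finrank_eq_rank, Cardinal.toENat_nat]

theorem edim_add_edim_quotient (U : Submodule ℂ V) : edim U + edim (V ⧸ U) = edim V := by
  rw [edim, edim, edim, ← map_add, add_comm, Submodule.rank_quotient_add_rank]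

theorem edim_ker_add_edim_range (f : V →ₗ[ℂ] W) :
    edim (LinearMap.ker f) + edim (LinearMap.range f) = edim V := by
  rw [← edim_congr f.quotKerEquivRange, edim_add_edim_quotient]

theorem edim_le_of_injective (f : V →ₗ[ℂ] W) (hf : Function.Injective f) : edim V ≤ edim W := by
  rw [edim_congr (LinearEquiv.ofInjective f hf), ← edim_add_edim_quotient (LinearMap.range f)]
  exact le_self_add

theorem edim_eq_zero : edim V = 0 ↔ Subsingleton V := by
  rw [edim, Cardinal.toENat_eq_zero, rank_zero_iff]

theorem natCast_le_edim {n : ℕ} :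
    (n : ℕ∞) ≤ edim V ↔ ∃ f : (Fin n → ℂ) →ₗ[ℂ] V, Function.Injective f := by
  constructor
  · intro h
    have h' : (n : Cardinal) ≤ Module.rank ℂ V := by
      simpa [edim] using h
    obtain ⟨s, hs, hli⟩ := (le_rank_iff_exists_linearIndependent_finset).1 h'
    let v : Fin n → V := fun i => ((Finset.equivFinOfCardEq hs).symm i : V)
    have hv : LinearIndependent ℂ v := hli.comp _ (Finset.equivFinOfCardEq hs).symm.injective
    exact ⟨Fintype.linearCombination ℂ v, hv.fintypeLinearCombination_injective⟩
  · rintro ⟨f, hf⟩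
    have := edim_le_of_injective f hf
    rwa [edim_of_finiteDimensional, Module.finrank_fin_fun] at this

/-- Euler characteristic of the map `V ⧸ Z → W ⧸ L(Z)` induced by `L`, whose kernel and cokernel are
those of `L` because `L` is injective on `Z`. -/
theorem edim_ker_add_edim_quotient_map (L : V →ₗ[ℂ] W) (Z : Submodule ℂ V)
    (h : Disjoint (LinearMap.ker L) Z) :
    edim (LinearMap.ker L) + edim (W ⧸ Z.map L) = edim (V ⧸ Z) + edim (W ⧸ LinearMap.range L) := by
  let q : (V ⧸ Z) →ₗ[ℂ] (W ⧸ Z.map L) := Z.mapQ (Z.map L) L (Submodule.le_comap_map L Z)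
  have hker : edim (LinearMap.ker L) = edim (LinearMap.ker q) := by
    refine edim_congr (LinearEquiv.ofBijective
      ((Z.mkQ.domRestrict (LinearMap.ker L)).codRestrict (LinearMap.ker q) ?_) ⟨?_, ?_⟩)
    · rintro ⟨x, hx⟩
      simp only [LinearMap.mem_ker] at hx
      simp [q, hx]
    · rw [injective_iff_map_eq_zero]
      rintro ⟨x, hx⟩ h0
      have hxZ : x ∈ Z := by simpa [Subtype.ext_iff] using h0
      exact Subtype.ext (Submodule.disjoint_def.1 h x hx hxZ)
    · rintro ⟨y, hy⟩
      obtain ⟨x, rfl⟩ := Z.mkQ_surjective y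
      have : L x ∈ Z.map L := by simpa [q] using hy
      obtain ⟨z, hz, hzx⟩ := this
      refine ⟨⟨x - z, by simp [hzx]⟩, Subtype.ext ?_⟩
      simpa [Submodule.Quotient.eq] using hz
  have hcoker : edim (W ⧸ LinearMap.range L) = edim ((W ⧸ Z.map L) ⧸ LinearMap.range q) := by
    let g : W →ₗ[ℂ] ((W ⧸ Z.map L) ⧸ LinearMap.range q) :=
      (LinearMap.range q).mkQ ∘ₗ (Z.map L).mkQ
    have hg : LinearMap.ker g = LinearMap.range L := by
      ext y
      simp only [g, LinearMap.mem_ker, LinearMap.comp_apply, Submodule.mkQ_apply,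
        Submodule.Quotient.mk_eq_zero, LinearMap.mem_range]
      constructor
      · rintro ⟨x, hx⟩
        obtain ⟨x, rfl⟩ := Z.mkQ_surjective x
        have : L x - y ∈ Z.map L := by simpa [q, Submodule.Quotient.eq] using hx
        obtain ⟨z, -, hz⟩ := this
        exact ⟨x - z, by simp [hz]⟩
      · rintro ⟨x, rfl⟩
        exact ⟨Z.mkQ x, by simp [q]⟩
    rw [← hg]
    exact edim_congr (g.quotKerEquivOfSurjective
      ((Submodule.mkQ_surjective _).comp (Submodule.mkQ_surjective _)))
  rw [hker, hcoker, ← edim_ker_add_edim_range q, ← edim_add_edim_quotient (LinearMap.range q),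
    add_assoc]

theorem edim_strongDual (E : Type*) [NormedAddCommGroup E] [NormedSpace ℂ E] :
    edim (StrongDual ℂ E) = edim E := by
  by_cases hE : FiniteDimensional ℂ E
  · rw [← edim_congr (LinearMap.toContinuousLinearMap : Module.Dual ℂ E ≃ₗ[ℂ] StrongDual ℂ E),
      edim_of_finiteDimensional, edim_of_finiteDimensional, Subspace.dual_finrank_eq]
  · have hE' : ¬ FiniteDimensional ℂ (StrongDual ℂ E) := by
      -- otherwise the bidual, into which `E` embeds, would be finite-dimensional
      intro _
      have : FiniteDimensional ℂ (StrongDual ℂ (StrongDual ℂ E)) :=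
        (LinearMap.toContinuousLinearMap :
          Module.Dual ℂ (StrongDual ℂ E) ≃ₗ[ℂ] StrongDual ℂ (StrongDual ℂ E)).finiteDimensional
      let J : E →ₗ[ℂ] StrongDual ℂ (StrongDual ℂ E) :=
        (NormedSpace.inclusionInDoubleDual ℂ E).toLinearMap
      have hJ : Function.Injective J := (NormedSpace.inclusionInDoubleDualLi ℂ (E := E)).injective
      exact hE (edim_lt_top.1 ((edim_le_of_injective J hJ).trans_lt (edim_lt_top.2 this)))
    rw [← edim_lt_top, not_lt_top_iff] at hE hE'
    rw [hE, hE']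

end edim

/-! ### Adjoints of operators with closed range -/

section duality

-- multiplication on `StrongDual ℂ X →L[ℂ] StrongDual ℂ X` is slow to synthesize
set_option synthInstance.maxHeartbeats 100000

variable {X : Type*} [NormedAddCommGroup X] [NormedSpace ℂ X]

@[simp]
theorem adjoint_apply (S : X →L[ℂ] X) (f : StrongDual ℂ X) (x : X) : adjoint S f x = f (S x) := rfl

theorem adjoint_mul (A B : X →L[ℂ] X) : adjoint (A * B) = adjoint B * adjoint A := rfl

theorem adjoint_one : adjoint (1 : X →L[ℂ] X) = 1 := rfl

theorem adjoint_sub_smul_one (S : X →L[ℂ] X) (c : ℂ) :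
    adjoint (S - c • 1) = adjoint S - c • 1 := by
  ext f x
  simp

theorem isQuasiNilpotent_adjoint {S : X →L[ℂ] X} (hS : IsQuasiNilpotent S) :
    IsQuasiNilpotent (adjoint S) := by
  intro c hc
  by_contra hc0
  have hu : IsUnit (algebraMap ℂ (X →L[ℂ] X) c - S) := by
    by_contra h
    exact hc0 (hS h)
  obtain ⟨R, hR, hR'⟩ := isUnit_iff_exists.1 hu
  refine hc (isUnit_iff_exists.2 ⟨adjoint R, ?_, ?_⟩)
  · have h := congrArg adjoint hR'
    rw [adjoint_mul, adjoint_one] at h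
    rw [← h]
    congr 1
    ext f x
    simp [Algebra.algebraMap_eq_smul_one]
  · have h := congrArg adjoint hR
    rw [adjoint_mul, adjoint_one] at h
    rw [← h]
    congr 1
    ext f x
    simp [Algebra.algebraMap_eq_smul_one]

/-- The functionals vanishing on a subspace. -/
def annihilator (U : Submodule ℂ X) : Submodule ℂ (StrongDual ℂ X) where
  carrier := {f | ∀ x ∈ U, f x = 0}
  add_mem' hf hg x hx := by simp [hf x hx, hg x hx]
  zero_mem' x _ := rfl
  smul_mem' c f hf x hx := by simp [hf x hx]

theorem mem_annihilator {U : Submodule ℂ X} {f : StrongDual ℂ X} :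
    f ∈ annihilator U ↔ ∀ x ∈ U, f x = 0 := Iff.rfl

theorem isClosed_annihilator (U : Submodule ℂ X) :
    IsClosed (annihilator U : Set (StrongDual ℂ X)) := by
  have : (annihilator U : Set (StrongDual ℂ X)) = ⋂ x ∈ U, {f | f x = 0} := by
    ext f
    simp [mem_annihilator]
  rw [this]
  refine isClosed_biInter fun x _ => isClosed_eq ?_ continuous_const
  exact (ContinuousLinearMap.apply ℂ ℂ x).continuous

theorem edim_annihilator {U : Submodule ℂ X} (hU : IsClosed (U : Set X)) :
    edim (annihilator U) = edim (X ⧸ U) := by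
  have : IsClosed (U : Set X) := hU
  rw [← edim_strongDual (X ⧸ U)]
  refine edim_congr (LinearEquiv.symm (LinearEquiv.ofBijective
    (((ContinuousLinearMap.precomp ℂ U.mkQL).toLinearMap).codRestrict (annihilator U) ?_)
      ⟨?_, ?_⟩))
  · intro f x hx
    have : U.mkQL x = 0 := (Submodule.Quotient.mk_eq_zero U).2 hx
    exact (congrArg f this).trans (map_zero f)
  · intro f g h
    ext y
    obtain ⟨x, rfl⟩ := U.mkQ_surjective y
    exact DFunLike.congr_fun (congrArg Subtype.val h) x
  · rintro ⟨f, hf⟩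
    refine ⟨U.liftQL f fun x hx => hf x hx, Subtype.ext ?_⟩
    ext x
    rfl

theorem edim_quotient_annihilator (U : Submodule ℂ X) :
    edim (StrongDual ℂ X ⧸ annihilator U) = edim U := by
  let r : StrongDual ℂ X →ₗ[ℂ] StrongDual ℂ U :=
    (ContinuousLinearMap.precomp ℂ U.subtypeL).toLinearMap
  have hr : LinearMap.ker r = annihilator U := by
    ext f
    simp only [LinearMap.mem_ker, mem_annihilator]
    constructor
    · intro h x hx
      exact DFunLike.congr_fun h ⟨x, hx⟩
    · intro h
      ext x
      exact h x x.2
  rw [← edim_strongDual U, ← hr]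
  refine edim_congr (r.quotKerEquivOfSurjective fun g => ?_)
  obtain ⟨f, hf, -⟩ := exists_extension_norm_eq U g
  exact ⟨f, by ext x; exact hf x⟩

theorem ker_adjoint (S : X →L[ℂ] X) :
    LinearMap.ker (adjoint S).toLinearMap = annihilator (LinearMap.range S.toLinearMap) := by
  ext f
  simp only [LinearMap.mem_ker, mem_annihilator]
  constructor
  · rintro h _ ⟨x, rfl⟩
    exact DFunLike.congr_fun h x
  · intro h
    ext x
    exact h _ ⟨x, rfl⟩

/-- The open mapping theorem for the corestriction of an operator to its closed range. -/
theorem exists_preimage_norm_le_of_isClosed_range [CompleteSpace X] {S : X →L[ℂ] X}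
    (hS : IsClosed (Set.range S)) :
    ∃ C > 0, ∀ y ∈ LinearMap.range S.toLinearMap, ∃ x, S x = y ∧ ‖x‖ ≤ C * ‖y‖ := by
  have hS' : IsClosed (LinearMap.range S.toLinearMap : Set X) := hS
  have := hS'.completeSpace_coe
  obtain ⟨C, hC, h⟩ := S.rangeRestrict.exists_preimage_norm_le
    S.toLinearMap.surjective_rangeRestrict
  refine ⟨C, hC, fun y hy => ?_⟩
  obtain ⟨x, hx, hxn⟩ := h ⟨y, hy⟩
  exact ⟨x, congrArg Subtype.val hx, hxn⟩

/-- A functional vanishing on `ker S` induces a functional on `range S`, bounded by the open mapping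
theorem, which then extends to `X`. -/
theorem exists_comp_eq_of_isClosed_range [CompleteSpace X] {S : X →L[ℂ] X}
    (hS : IsClosed (Set.range S)) {f : StrongDual ℂ X}
    (hf : f ∈ annihilator (LinearMap.ker S.toLinearMap)) : ∃ g, adjoint S g = f := by
  obtain ⟨C, hC, h⟩ := exists_preimage_norm_le_of_isClosed_range hS
  let φ : LinearMap.range S.toLinearMap →ₗ[ℂ] ℂ :=
    (LinearMap.ker S.toLinearMap).liftQ f.toLinearMap (fun x hx => hf x hx) ∘ₗ
      S.toLinearMap.quotKerEquivRange.symm.toLinearMap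
  have hφ : ∀ x, φ ⟨S x, x, rfl⟩ = f x := by
    intro x
    have : (⟨S x, x, rfl⟩ : LinearMap.range S.toLinearMap) =
      S.toLinearMap.quotKerEquivRange (Submodule.Quotient.mk x) := rfl
    simp only [φ, LinearMap.comp_apply, this, LinearEquiv.coe_coe, LinearEquiv.symm_apply_apply]
    rfl
  have hb : ∀ y, ‖φ y‖ ≤ ‖f‖ * C * ‖y‖ := by
    rintro ⟨y, hy⟩
    obtain ⟨x, rfl, hx⟩ := h y hy
    rw [hφ, mul_assoc]
    exact (f.le_opNorm x).trans (by gcongr; exact hx)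
  obtain ⟨g, hg, -⟩ := exists_extension_norm_eq _ (φ.mkContinuous _ hb)
  refine ⟨g, ?_⟩
  ext x
  exact (hg ⟨S x, x, rfl⟩).trans (hφ x)

theorem range_adjoint [CompleteSpace X] {S : X →L[ℂ] X} (hS : IsClosed (Set.range S)) :
    LinearMap.range (adjoint S).toLinearMap = annihilator (LinearMap.ker S.toLinearMap) := by
  ext f
  constructor
  · rintro ⟨g, rfl⟩ x hx
    have hx : S x = 0 := hx
    simp [hx]
  · exact fun hf => exists_comp_eq_of_isClosed_range hS hf

theorem isClosed_range_adjoint [CompleteSpace X] {S : X →L[ℂ] X} (hS : IsClosed (Set.range S)) :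
    IsClosed (Set.range (adjoint S)) := by
  have := isClosed_annihilator (LinearMap.ker S.toLinearMap)
  rwa [← range_adjoint hS] at this

theorem kerDim_adjoint {S : X →L[ℂ] X} (hS : IsClosed (Set.range S)) :
    kerDim (adjoint S) = rangeCodim S := by
  change edim (LinearMap.ker (adjoint S).toLinearMap) = edim _
  rw [ker_adjoint, edim_annihilator hS]

theorem rangeCodim_adjoint [CompleteSpace X] {S : X →L[ℂ] X} (hS : IsClosed (Set.range S)) :
    rangeCodim (adjoint S) = kerDim S := by
  change edim (_ ⧸ LinearMap.range (adjoint S).toLinearMap) = edim _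
  rw [range_adjoint hS, edim_quotient_annihilator]

theorem isClosed_range_of_rangeCodim_lt_top [CompleteSpace X] {S : X →L[ℂ] X}
    (hS : rangeCodim S < ⊤) : IsClosed (Set.range S) := by
  have hfin : FiniteDimensional ℂ (X ⧸ LinearMap.range S.toLinearMap) := edim_lt_top.1 hS
  -- pass to the injective operator induced on the Banach space `X ⧸ ker S`
  have hker : IsClosed (LinearMap.ker S.toLinearMap : Set X) := S.isClosed_ker
  let S' : (X ⧸ LinearMap.ker S.toLinearMap) →L[ℂ] X :=
    (LinearMap.ker S.toLinearMap).liftQL S le_rfl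
  have hrange : LinearMap.range S'.toLinearMap = LinearMap.range S.toLinearMap :=
    Submodule.range_liftQ _ _ _
  obtain ⟨G, hG⟩ := (LinearMap.range S.toLinearMap).exists_isCompl
  have : FiniteDimensional ℂ G := (Submodule.quotientEquivOfIsCompl _ _ hG).finiteDimensional
  have hinj : LinearMap.ker S'.toLinearMap = ⊥ := Submodule.ker_liftQ_eq_bot _ _ _ le_rfl
  have := S'.closed_complemented_range_of_isCompl_of_ker_eq_bot G (hrange ▸ hG)
    G.closed_of_finiteDimensional hinj
  rw [hrange] at this
  exact this

end duality

/-! ### Semi-regular operators -/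

section semiRegular

set_option synthInstance.maxHeartbeats 100000

variable {X : Type*} [NormedAddCommGroup X] [NormedSpace ℂ X]

theorem IsSemiRegular.ker_le {S : X →L[ℂ] X} (hS : IsSemiRegular S) {x : X} (hx : S x = 0) (n : ℕ) :
    ∃ y, (S ^ n) y = x := by
  have : x ∈ ⨅ n : ℕ, LinearMap.range (S ^ n).toLinearMap := hS.2 hx
  exact Submodule.mem_iInf _ |>.1 this n

/-- By induction on `n`: if `Sⁿ⁺¹ x = 0` then `Sⁿ x ∈ ker S` equals some `Sⁿ⁺¹ y`, and `x - S y` lies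
in `ker Sⁿ`. -/
theorem IsSemiRegular.ker_pow_le_range {S : X →L[ℂ] X} (hS : IsSemiRegular S) (n : ℕ) {x : X}
    (hx : (S ^ n) x = 0) : ∃ y, S y = x := by
  induction n generalizing x with
  | zero => exact ⟨0, by simpa using hx.symm⟩
  | succ n ih =>
    obtain ⟨y, hy⟩ := hS.ker_le (x := (S ^ n) x) (by rwa [pow_succ'] at hx) (n + 1)
    obtain ⟨z, hz⟩ := ih (x := x - S y) (by
      rw [map_sub, ← hy, pow_succ, mul_apply_eq_comp, sub_self])
    exact ⟨z + y, by rw [map_add, hz, sub_add_cancel]⟩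

/-- A functional vanishing on `ker Sⁿ` lies in the range of `(S*)ⁿ`.  Writing it as `g ∘ S`, the
functional `g` vanishes on `ker Sⁿ⁻¹ = S (ker Sⁿ)`, so no closedness of `range Sⁿ` is needed. -/
theorem IsSemiRegular.exists_comp_pow_eq [CompleteSpace X] {S : X →L[ℂ] X} (hS : IsSemiRegular S)
    (n : ℕ) {f : StrongDual ℂ X} (hf : ∀ x, (S ^ n) x = 0 → f x = 0) :
    ∃ g, (adjoint S ^ n) g = f := by
  induction n generalizing f with
  | zero => exact ⟨f, rfl⟩
  | succ n ih =>
    obtain ⟨g, rfl⟩ := exists_comp_eq_of_isClosed_range hS.1 (f := f) fun x hx =>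
      hf x (by rw [pow_succ, mul_apply_eq_comp, show S x = 0 from hx, map_zero])
    obtain ⟨h, rfl⟩ := ih (f := g) fun x hx => by
      obtain ⟨y, rfl⟩ := hS.ker_pow_le_range n hx
      exact hf y (by rwa [pow_succ])
    exact ⟨h, by rw [pow_succ']; rfl⟩

theorem isSemiRegular_adjoint [CompleteSpace X] {S : X →L[ℂ] X} (hS : IsSemiRegular S) :
    IsSemiRegular (adjoint S) := by
  refine ⟨isClosed_range_adjoint hS.1, fun f hf => (Submodule.mem_iInf _).2 fun n => ?_⟩
  refine hS.exists_comp_pow_eq n fun x hx => ?_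
  obtain ⟨y, rfl⟩ := hS.ker_pow_le_range n hx
  exact DFunLike.congr_fun (show adjoint S f = 0 from hf) y

theorem operatorAscent_eq_zero {S : X →L[ℂ] X} (h : kerDim S = 0) : operatorAscent S = 0 := by
  have hsub : Subsingleton (LinearMap.ker S.toLinearMap) := edim_eq_zero.1 h
  have hinj : Function.Injective S :=
    LinearMap.ker_eq_bot.1 (Submodule.subsingleton_iff_eq_bot.1 hsub)
  have hpow : ∀ m, LinearMap.ker (S ^ m).toLinearMap = ⊥ := fun m => by
    rw [LinearMap.ker_eq_bot]
    change Function.Injective (S ^ m)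
    rw [FunLike.coe_pow_eq_iterate]
    exact hinj.iterate m
  refine le_antisymm (iInf₂_le_of_le 0 (fun m _ => ?_) le_rfl) bot_le
  rw [hpow, hpow]

/-- A nonzero `x ∈ ker S` is of the form `Sⁿ y` for each `n`, so that `ker Sⁿ ≠ ker Sⁿ⁺¹`. -/
theorem IsSemiRegular.operatorAscent_eq_top {S : X →L[ℂ] X} (hS : IsSemiRegular S)
    (h : kerDim S ≠ 0) : operatorAscent S = ⊤ := by
  refine iInf₂_eq_top.2 fun n hn => (h ?_).elim
  refine edim_eq_zero.2 (Submodule.subsingleton_iff_eq_bot.2 ((Submodule.eq_bot_iff _).2 ?_))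
  intro x hx
  obtain ⟨y, rfl⟩ := hS.ker_le hx n
  have hy : y ∈ LinearMap.ker (S ^ (n + 1)).toLinearMap := by
    rw [pow_succ']
    exact hx
  rw [← hn (n + 1) n.le_succ] at hy
  exact hy

theorem operatorDescent_eq_zero {S : X →L[ℂ] X} (h : rangeCodim S = 0) : operatorDescent S = 0 := by
  have hsub : Subsingleton (X ⧸ LinearMap.range S.toLinearMap) := edim_eq_zero.1 h
  have hsurj : Function.Surjective S :=
    LinearMap.range_eq_top.1 (Submodule.Quotient.subsingleton_iff.1 hsub)
  have hpow : ∀ m, LinearMap.range (S ^ m).toLinearMap = ⊤ := fun m => by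
    rw [LinearMap.range_eq_top]
    change Function.Surjective (S ^ m)
    rw [FunLike.coe_pow_eq_iterate]
    exact hsurj.iterate m
  refine le_antisymm (iInf₂_le_of_le 0 (fun m _ => ?_) le_rfl) bot_le
  rw [hpow, hpow]

/-- If `range Sⁿ = range Sⁿ⁺¹` then `X = range S + ker Sⁿ`, and `ker Sⁿ ≤ range S`. -/
theorem IsSemiRegular.operatorDescent_eq_top {S : X →L[ℂ] X} (hS : IsSemiRegular S)
    (h : rangeCodim S ≠ 0) : operatorDescent S = ⊤ := by
  refine iInf₂_eq_top.2 fun n hn => (h ?_).elim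
  refine edim_eq_zero.2 (Submodule.Quotient.subsingleton_iff.2
    (LinearMap.range_eq_top.2 fun x => ?_))
  have hx : (S ^ n) x ∈ LinearMap.range (S ^ (n + 1)).toLinearMap := by
    rw [← hn (n + 1) n.le_succ]
    exact ⟨x, rfl⟩
  obtain ⟨y, hy⟩ := hx
  have hy : (S ^ n) (S y) = (S ^ n) x := by rwa [pow_succ] at hy
  obtain ⟨z, hz⟩ := hS.ker_pow_le_range n (x := x - S y) (by rw [map_sub, hy, sub_self])
  exact ⟨z + y, by simp [hz]⟩

open Classical in
theorem IsSemiRegular.operatorAscent_eq {S : X →L[ℂ] X} (hS : IsSemiRegular S) :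
    operatorAscent S = if kerDim S = 0 then 0 else ⊤ := by
  split_ifs with h
  · exact operatorAscent_eq_zero h
  · exact hS.operatorAscent_eq_top h

open Classical in
theorem IsSemiRegular.operatorDescent_eq {S : X →L[ℂ] X} (hS : IsSemiRegular S) :
    operatorDescent S = if rangeCodim S = 0 then 0 else ⊤ := by
  split_ifs with h
  · exact operatorDescent_eq_zero h
  · exact hS.operatorDescent_eq_top h

end semiRegular

/-! ### Invariance under similarity -/

section similarity

/-! Here `e` intertwines `A` and `B`, that is, `B = e A e⁻¹`. -/

variable {E F : Type*} [NormedAddCommGroup E] [NormedSpace ℂ E]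
  [NormedAddCommGroup F] [NormedSpace ℂ F]
  {A : E →L[ℂ] E} {B : F →L[ℂ] F} (e : E ≃L[ℂ] F)

theorem map_range_of_conj (h : ∀ x, e (A x) = B (e x)) :
    (LinearMap.range A.toLinearMap).map e.toLinearEquiv.toLinearMap =
      LinearMap.range B.toLinearMap := by
  ext y
  constructor
  · rintro ⟨_, ⟨x, rfl⟩, rfl⟩
    exact ⟨e x, (h x).symm⟩
  · rintro ⟨x, rfl⟩
    refine ⟨A (e.symm x), ⟨e.symm x, rfl⟩, ?_⟩
    exact (h _).trans (by simp)

theorem map_ker_of_conj (h : ∀ x, e (A x) = B (e x)) :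
    (LinearMap.ker A.toLinearMap).map e.toLinearEquiv.toLinearMap =
      LinearMap.ker B.toLinearMap := by
  ext y
  constructor
  · rintro ⟨x, hx, rfl⟩
    have hx : A x = 0 := hx
    exact (h x).symm.trans (by rw [hx, map_zero])
  · intro hy
    have hy : B y = 0 := hy
    refine ⟨e.symm y, ?_, e.apply_symm_apply y⟩
    exact e.injective (by
      rw [ContinuousLinearMap.coe_coe, h, e.apply_symm_apply, hy, map_zero])

theorem kerDim_of_conj (h : ∀ x, e (A x) = B (e x)) : kerDim A = kerDim B := by
  change edim _ = edim _
  rw [← map_ker_of_conj e h]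
  exact edim_congr (e.toLinearEquiv.submoduleMap _)

theorem rangeCodim_of_conj (h : ∀ x, e (A x) = B (e x)) : rangeCodim A = rangeCodim B :=
  edim_congr (Submodule.Quotient.equiv _ _ e.toLinearEquiv (map_range_of_conj e h))

theorem isClosed_range_of_conj (h : ∀ x, e (A x) = B (e x)) (hA : IsClosed (Set.range A)) :
    IsClosed (Set.range B) := by
  have : Set.range B = e '' Set.range A :=
    (congrArg (SetLike.coe : Submodule ℂ F → Set F) (map_range_of_conj e h)).symm
  rw [this]
  exact e.toHomeomorph.isClosedMap _ hA

theorem pow_conj (h : ∀ x, e (A x) = B (e x)) (n : ℕ) (x : E) : e ((A ^ n) x) = (B ^ n) (e x) := by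
  induction n generalizing x with
  | zero => rfl
  | succ n ih => rw [pow_succ, pow_succ, mul_apply_eq_comp, mul_apply_eq_comp, ih, h]

theorem isSemiRegular_of_conj (h : ∀ x, e (A x) = B (e x)) (hA : IsSemiRegular A) :
    IsSemiRegular B := by
  refine ⟨isClosed_range_of_conj e h hA.1, fun y hy => (Submodule.mem_iInf _).2 fun n => ?_⟩
  rw [← map_ker_of_conj e h] at hy
  obtain ⟨x, hx, rfl⟩ := hy
  obtain ⟨z, rfl⟩ := hA.ker_le hx n
  exact ⟨e z, (pow_conj e h n z).symm⟩

theorem isQuasiNilpotent_of_conj (h : ∀ x, e (A x) = B (e x)) (hA : IsQuasiNilpotent A) :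
    IsQuasiNilpotent B := by
  have hB : B = e.conjContinuousAlgEquiv A := by
    ext y
    simp [h]
  unfold IsQuasiNilpotent at *
  rwa [hB, AlgEquiv.spectrum_eq e.conjContinuousAlgEquiv]

end similarity

/-! ### Reducing decompositions -/

namespace Red

variable {X : Type*} [NormedAddCommGroup X] [NormedSpace ℂ X] {T : X →L[ℂ] X}

@[simp]
theorem coe_onM (d : Red T) (x : d.M) : (d.onM x : X) = T x := rfl

@[simp]
theorem coe_onN (d : Red T) (x : d.N) : (d.onN x : X) = T x := rfl

theorem coe_onM_pow (d : Red T) (n : ℕ) (x : d.M) :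
    ((d.onM ^ n) x : X) = (T ^ n) x := by
  induction n generalizing x with
  | zero => rfl
  | succ n ih => rw [pow_succ, pow_succ, mul_apply_eq_comp, mul_apply_eq_comp, ih, Red.coe_onM]

theorem map_ker_onM (d : Red T) :
    (LinearMap.ker d.onM.toLinearMap).map d.M.subtype = d.M ⊓ LinearMap.ker T.toLinearMap := by
  ext x
  constructor
  · rintro ⟨y, hy, rfl⟩
    exact ⟨y.2, congrArg Subtype.val (show d.onM y = 0 from hy)⟩
  · rintro ⟨hx, hTx⟩
    exact ⟨⟨x, hx⟩, Subtype.ext hTx, rfl⟩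

/-- The same decomposition with the two summands exchanged. -/
def swap (d : Red T) : Red T where
  M := d.N
  N := d.M
  isClosed_M := d.isClosed_N
  isClosed_N := d.isClosed_M
  mapsTo_M := d.mapsTo_N
  mapsTo_N := d.mapsTo_M
  isCompl := d.isCompl.symm

/-- The same decomposition, regarded as a decomposition of `T - c`. -/
def shift (d : Red T) (c : ℂ) : Red (T - c • 1) where
  M := d.M
  N := d.N
  isClosed_M := d.isClosed_M
  isClosed_N := d.isClosed_N
  mapsTo_M x hx := d.M.sub_mem (d.mapsTo_M x hx) (d.M.smul_mem c hx)
  mapsTo_N x hx := d.N.sub_mem (d.mapsTo_N x hx) (d.N.smul_mem c hx)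
  isCompl := d.isCompl

theorem shift_onM (d : Red T) (c : ℂ) : (d.shift c).onM = (d.onM - c • 1 : d.M →L[ℂ] d.M) := rfl

variable [CompleteSpace X]

instance (d : Red T) : CompleteSpace d.M := d.isClosed_M.completeSpace_coe

instance (d : Red T) : CompleteSpace d.N := d.isClosed_N.completeSpace_coe

/-- The bounded projection onto `M` along `N`. -/
def proj (d : Red T) : X →L[ℂ] d.M :=
  d.M.projectionOntoL d.N
    (Submodule.IsCompl.isTopCompl_of_isClosed d.isCompl d.isClosed_M d.isClosed_N)

theorem proj_coe (d : Red T) (x : d.M) : d.proj x = x :=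
  Submodule.projectionOntoL_apply_left _ x

theorem proj_eq_zero_iff (d : Red T) {x : X} : d.proj x = 0 ↔ x ∈ d.N :=
  Submodule.projectionOntoL_apply_eq_zero_iff _

theorem sub_proj_mem (d : Red T) (x : X) : x - d.proj x ∈ d.N := by
  rw [← d.proj_eq_zero_iff, map_sub, d.proj_coe, sub_self]

theorem proj_apply (d : Red T) (x : X) : d.proj (T x) = d.onM (d.proj x) := by
  have h : d.proj (T (x - d.proj x)) = 0 :=
    d.proj_eq_zero_iff.2 (d.mapsTo_N _ (d.sub_proj_mem x))
  rw [map_sub, map_sub, sub_eq_zero] at h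
  rw [h, ← coe_onM, proj_coe]

theorem ker_eq_map_of_bijective (d : Red T) (h : Function.Bijective d.onN) :
    LinearMap.ker T.toLinearMap = (LinearMap.ker d.onM.toLinearMap).map d.M.subtype := by
  ext x
  constructor
  · intro hx
    have hx : T x = 0 := hx
    have hP : d.onM (d.proj x) = 0 := by rw [← proj_apply, hx, map_zero]
    have hN : (⟨x - d.proj x, d.sub_proj_mem x⟩ : d.N) = 0 := by
      refine h.1 (Subtype.ext ?_)
      rw [coe_onN, map_sub, hx, ← coe_onM, hP, map_zero]
      simp
    exact ⟨d.proj x, hP, (sub_eq_zero.1 (congrArg Subtype.val hN)).symm⟩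
  · rintro ⟨y, hy, rfl⟩
    exact congrArg Subtype.val (show d.onM y = 0 from hy)

theorem mem_range_iff_of_bijective (d : Red T) (h : Function.Bijective d.onN) {x : X} :
    x ∈ LinearMap.range T.toLinearMap ↔ d.proj x ∈ LinearMap.range d.onM.toLinearMap := by
  constructor
  · rintro ⟨y, rfl⟩
    exact ⟨d.proj y, (d.proj_apply y).symm⟩
  · rintro ⟨y, hy⟩
    obtain ⟨z, hz⟩ := h.2 ⟨x - d.proj x, d.sub_proj_mem x⟩
    have hz : T z = x - d.proj x := congrArg Subtype.val hz
    have hy : T y = d.proj x := congrArg Subtype.val hy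
    exact ⟨z + y, show T (z + y) = x by rw [map_add, hz, hy, sub_add_cancel]⟩

theorem kerDim_eq_of_bijective (d : Red T) (h : Function.Bijective d.onN) :
    kerDim T = kerDim d.onM := by
  change edim _ = edim _
  rw [d.ker_eq_map_of_bijective h]
  exact (edim_congr (Submodule.equivSubtypeMap _ _)).symm

theorem rangeCodim_eq_of_bijective (d : Red T) (h : Function.Bijective d.onN) :
    rangeCodim T = rangeCodim d.onM := by
  let g : X →ₗ[ℂ] d.M ⧸ LinearMap.range d.onM.toLinearMap :=
    (LinearMap.range d.onM.toLinearMap).mkQ ∘ₗ d.proj.toLinearMap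
  have hg : LinearMap.ker g = LinearMap.range T.toLinearMap := by
    ext x
    rw [d.mem_range_iff_of_bijective h]
    exact Submodule.Quotient.mk_eq_zero _
  change edim _ = edim _
  rw [← hg]
  refine edim_congr (g.quotKerEquivOfSurjective
    ((Submodule.mkQ_surjective _).comp fun y => ⟨y, d.proj_coe y⟩))

theorem isClosed_range_of_bijective (d : Red T) (h : Function.Bijective d.onN)
    (hM : IsClosed (Set.range d.onM)) : IsClosed (Set.range T) := by
  have : Set.range T = d.proj ⁻¹' Set.range d.onM :=
    Set.ext fun _ => d.mem_range_iff_of_bijective h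
  rw [this]
  exact hM.preimage d.proj.continuous

set_option synthInstance.maxHeartbeats 100000

/-- The dual decomposition `X* = N^⊥ ⊕ M^⊥` of the adjoint. -/
def dual (d : Red T) : Red (adjoint T) where
  M := annihilator d.N
  N := annihilator d.M
  isClosed_M := isClosed_annihilator _
  isClosed_N := isClosed_annihilator _
  mapsTo_M f hf x hx := hf _ (d.mapsTo_N x hx)
  mapsTo_N f hf x hx := hf _ (d.mapsTo_M x hx)
  isCompl := by
    constructor
    · rw [Submodule.disjoint_def]
      intro f hN hM
      ext x
      have h1 := hN _ (d.sub_proj_mem x)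
      have h2 := hM _ (d.proj x).2
      rw [map_sub, h2, sub_zero] at h1
      exact h1
    · rw [codisjoint_iff, eq_top_iff]
      intro f _
      -- the component of `f` in `N^⊥`
      let g : StrongDual ℂ X := (f ∘L d.M.subtypeL) ∘L d.proj
      have hg : g ∈ annihilator d.N := fun x hx => by
        simp [g, d.proj_eq_zero_iff.2 hx]
      have hfg : f - g ∈ annihilator d.M := fun x hx => by
        have : d.proj x = ⟨x, hx⟩ := d.proj_coe ⟨x, hx⟩
        simp [g, this]
      simpa using Submodule.add_mem_sup hg hfg

/-- Restriction to `M` identifies the functionals vanishing on `N` with the dual of `M`. -/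
def dualEquiv (d : Red T) : d.dual.M ≃L[ℂ] StrongDual ℂ d.M :=
  ContinuousLinearEquiv.equivOfInverse
    (ContinuousLinearMap.precomp ℂ d.M.subtypeL ∘L d.dual.M.subtypeL)
    ((ContinuousLinearMap.precomp ℂ d.proj).codRestrict d.dual.M fun f x hx => by
      simp [d.proj_eq_zero_iff.2 hx])
    (fun f => by
      ext x
      have h := f.2 _ (d.sub_proj_mem x)
      rw [map_sub, sub_eq_zero] at h
      exact h.symm)
    (fun f => by
      ext x
      exact congrArg f (d.proj_coe x))

theorem dualEquiv_conj (d : Red T) (f : d.dual.M) :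
    d.dualEquiv (d.dual.onM f) = adjoint d.onM (d.dualEquiv f) := rfl

theorem dualEquiv_symm_conj (d : Red T) (f : StrongDual ℂ d.M) :
    d.dualEquiv.symm (adjoint d.onM f) = d.dual.onM (d.dualEquiv.symm f) := by
  rw [ContinuousLinearEquiv.symm_apply_eq, dualEquiv_conj, ContinuousLinearEquiv.apply_symm_apply]

theorem isQuasiNilpotent_dual_onN (d : Red T) (h : IsQuasiNilpotent d.onN) :
    IsQuasiNilpotent d.dual.onN :=
  isQuasiNilpotent_of_conj d.swap.dualEquiv.symm d.swap.dualEquiv_symm_conj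
    (isQuasiNilpotent_adjoint h)

theorem kerDim_dual_onM (d : Red T) (h : IsClosed (Set.range d.onM)) :
    kerDim d.dual.onM = rangeCodim d.onM :=
  (kerDim_of_conj d.dualEquiv d.dualEquiv_conj).trans (kerDim_adjoint h)

theorem rangeCodim_dual_onM (d : Red T) (h : IsClosed (Set.range d.onM)) :
    rangeCodim d.dual.onM = kerDim d.onM :=
  (rangeCodim_of_conj d.dualEquiv d.dualEquiv_conj).trans (rangeCodim_adjoint h)

theorem isClosed_range_dual_onM (d : Red T) (h : IsClosed (Set.range d.onM)) :
    IsClosed (Set.range d.dual.onM) :=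
  isClosed_range_of_conj d.dualEquiv.symm d.dualEquiv_symm_conj (isClosed_range_adjoint h)

theorem IsGKD.dual {d : Red T} (h : d.IsGKD) : d.dual.IsGKD :=
  ⟨isSemiRegular_of_conj d.dualEquiv.symm d.dualEquiv_symm_conj (isSemiRegular_adjoint h.1),
    d.isQuasiNilpotent_dual_onN h.2⟩

end Red

/-! ### The kernel of the semi-regular part -/

section kernel

open Filter Topology

variable {X : Type*} [NormedAddCommGroup X] [NormedSpace ℂ X] [CompleteSpace X]

/-- The kernel of a semi-regular operator lies in its analytic core: the open mapping theorem gives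
backward orbits of geometric growth, which never leave `⋃ ker Sⁿ ≤ range S`. -/
theorem IsSemiRegular.exists_backward_orbit {S : X →L[ℂ] X} (hS : IsSemiRegular S) :
    ∃ C > 0, ∀ x, S x = 0 → ∃ u : ℕ → X, ∀ n, (S ^ n) (u n) = x ∧ ‖u n‖ ≤ C ^ n * ‖x‖ := by
  obtain ⟨C, hC, h⟩ := exists_preimage_norm_le_of_isClosed_range hS.1
  refine ⟨C, hC, fun x hx => ?_⟩
  suffices ∀ n, ∃ y, (S ^ n) y = x ∧ ‖y‖ ≤ C ^ n * ‖x‖ from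
    ⟨fun n => (this n).choose, fun n => (this n).choose_spec⟩
  intro n
  induction n with
  | zero => exact ⟨x, rfl, by simp⟩
  | succ n ih =>
    obtain ⟨y, hy, hyn⟩ := ih
    have hy0 : (S ^ (n + 1)) y = 0 := by rw [pow_succ', mul_apply_eq_comp, hy, hx]
    obtain ⟨z, rfl, hzn⟩ := h y (hS.ker_pow_le_range (n + 1) hy0)
    refine ⟨z, by rwa [pow_succ], hzn.trans ?_⟩
    rw [pow_succ', mul_assoc]
    gcongr

theorem IsQuasiNilpotent.eventually_norm_pow_le {S : X →L[ℂ] X} (hS : IsQuasiNilpotent S) {r : ℝ}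
    (hr : 0 < r) : ∀ᶠ n : ℕ in atTop, ‖S ^ n‖ ≤ r ^ n := by
  have hrad : spectralRadius ℂ S = 0 := by
    refine le_antisymm (iSup₂_le fun c hc => ?_) bot_le
    have : c = 0 := hS hc
    simp [this]
  have hlim := spectrum.pow_norm_pow_one_div_tendsto_nhds_spectralRadius S
  rw [hrad] at hlim
  filter_upwards [hlim.eventually_lt_const (ENNReal.ofReal_pos.2 hr), eventually_gt_atTop 0]
    with n hn hn0
  have hlt := (ENNReal.ofReal_lt_ofReal_iff hr).1 hn
  calc ‖S ^ n‖ = (‖S ^ n‖ ^ (1 / n : ℝ)) ^ n := by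
        rw [one_div, Real.rpow_inv_natCast_pow (norm_nonneg _) hn0.ne']
    _ ≤ r ^ n := by gcongr

/-- A quasi-nilpotent operator has no nonzero backward orbit of geometric growth. -/
theorem IsQuasiNilpotent.eq_zero_of_backward_orbit {S : X →L[ℂ] X} (hS : IsQuasiNilpotent S)
    {x : X} {u : ℕ → X} {C D : ℝ} (hC : 0 < C) (hu : ∀ n, (S ^ n) (u n) = x)
    (hb : ∀ n, ‖u n‖ ≤ C ^ n * D) : x = 0 := by
  have hev : ∀ᶠ n : ℕ in atTop, ‖x‖ ≤ (1 / 2) ^ n * D := by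
    filter_upwards [hS.eventually_norm_pow_le (r := 1 / (2 * C)) (by positivity)] with n hn
    calc ‖x‖ = ‖(S ^ n) (u n)‖ := by rw [hu]
      _ ≤ ‖S ^ n‖ * ‖u n‖ := (S ^ n).le_opNorm _
      _ ≤ (1 / (2 * C)) ^ n * (C ^ n * D) := by gcongr; exact hb n
      _ = (1 / 2) ^ n * D := by
        rw [← mul_assoc, ← mul_pow]
        congr 2
        field_simp
  have hlim : Tendsto (fun n : ℕ => (1 / 2 : ℝ) ^ n * D) atTop (𝓝 (0 * D)) :=
    (tendsto_pow_atTop_nhds_zero_of_lt_one (by norm_num) (by norm_num)).mul_const D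
  rw [zero_mul] at hlim
  exact norm_le_zero_iff.1 (ge_of_tendsto hlim hev)

theorem Red.proj_pow_apply {T : X →L[ℂ] X} (d : Red T) (n : ℕ) (x : X) :
    d.proj ((T ^ n) x) = (d.onM ^ n) (d.proj x) := by
  induction n generalizing x with
  | zero => rfl
  | succ n ih => rw [pow_succ, pow_succ, mul_apply_eq_comp, mul_apply_eq_comp, ih, Red.proj_apply]

/-- A backward orbit in `M` of a vector of `ker T_M` projects to a backward orbit of `T_{N'}`, hence
the vector has no component in `N'`. -/
theorem Red.mem_M_of_ker {T : X →L[ℂ] X} (d d' : Red T) (hM : IsSemiRegular d.onM)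
    (hN : IsQuasiNilpotent d'.onN) {x : X} (hx : x ∈ d.M) (hTx : T x = 0) : x ∈ d'.M := by
  obtain ⟨C, hC, h⟩ := hM.exists_backward_orbit
  obtain ⟨u, hu⟩ := h ⟨x, hx⟩ (Subtype.ext hTx)
  refine d'.swap.proj_eq_zero_iff.1 (IsQuasiNilpotent.eq_zero_of_backward_orbit hN
    (u := fun n => d'.swap.proj (u n)) (D := ‖d'.swap.proj‖ * ‖x‖) hC (fun n => ?_) fun n => ?_)
  · have := d'.swap.proj_pow_apply n (u n)
    rw [← d.coe_onM_pow, (hu n).1] at this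
    exact this.symm
  · calc ‖d'.swap.proj (u n)‖ ≤ ‖d'.swap.proj‖ * ‖(u n : X)‖ := d'.swap.proj.le_opNorm _
      _ ≤ ‖d'.swap.proj‖ * (C ^ n * ‖x‖) := by gcongr; exact (hu n).2
      _ = C ^ n * (‖d'.swap.proj‖ * ‖x‖) := by ring

theorem Red.kerDim_onM_eq {T : X →L[ℂ] X} {d d' : Red T} (h : d.IsGKD) (h' : d'.IsGKD) :
    kerDim d.onM = kerDim d'.onM := by
  have hmap : (LinearMap.ker d.onM.toLinearMap).map d.M.subtype =
      (LinearMap.ker d'.onM.toLinearMap).map d'.M.subtype := by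
    rw [d.map_ker_onM, d'.map_ker_onM]
    ext x
    exact ⟨fun hx => ⟨d.mem_M_of_ker d' h.1 h'.2 hx.1 hx.2, hx.2⟩,
      fun hx => ⟨d'.mem_M_of_ker d h'.1 h.2 hx.1 hx.2, hx.2⟩⟩
  exact (edim_congr (Submodule.equivSubtypeMap _ _)).trans
    (hmap ▸ (edim_congr (Submodule.equivSubtypeMap _ _)).symm)

/-- Duality turns the codimension of the range into the dimension of a kernel. -/
theorem Red.rangeCodim_onM_eq {T : X →L[ℂ] X} {d d' : Red T} (h : d.IsGKD) (h' : d'.IsGKD) :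
    rangeCodim d.onM = rangeCodim d'.onM := by
  rw [← d.kerDim_dual_onM h.1.1, ← d'.kerDim_dual_onM h'.1.1, Red.kerDim_onM_eq h.dual h'.dual]

end kernel

/-! ### Stability of the index -/

section stability

open Filter Topology

variable {E F : Type*} [NormedAddCommGroup E] [NormedSpace ℂ E]
  [NormedAddCommGroup F] [NormedSpace ℂ F]

/-- The operators bounded below form an open set. -/
theorem eventually_exists_antilipschitzWith {A : E →L[ℂ] F} (hA : ∃ K, AntilipschitzWith K A) :
    ∀ᶠ B : E →L[ℂ] F in 𝓝 A, ∃ K, AntilipschitzWith K B := by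
  obtain ⟨K, hK⟩ := hA
  -- `K + 1` in place of `K`, which may vanish
  have hK1 : (0 : ℝ) < K + 1 := by positivity
  filter_upwards [Metric.ball_mem_nhds A (show 0 < 1 / (2 * ((K : ℝ) + 1)) by positivity)] with B hB
  refine ⟨2 * (K + 1), B.antilipschitz_of_bound fun x => ?_⟩
  rw [mem_ball_iff_norm] at hB
  have h1 : ‖x‖ ≤ (K + 1) * ‖A x‖ :=
    (A.bound_of_antilipschitz hK x).trans (by gcongr; linarith)
  have h2 : ‖A x‖ ≤ ‖B x‖ + 1 / (2 * ((K : ℝ) + 1)) * ‖x‖ := by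
    calc ‖A x‖ = ‖B x - (B - A) x‖ := by simp
      _ ≤ ‖B x‖ + ‖(B - A) x‖ := norm_sub_le _ _
      _ ≤ ‖B x‖ + 1 / (2 * ((K : ℝ) + 1)) * ‖x‖ := by
        gcongr
        exact (B - A).le_of_opNorm_le hB.le x
  have h3 : ((K : ℝ) + 1) * (1 / (2 * ((K : ℝ) + 1)) * ‖x‖) = ‖x‖ / 2 := by field_simp
  have h4 := mul_le_mul_of_nonneg_left h2 hK1.le
  rw [mul_add, h3] at h4
  push_cast
  linarith

variable {n : ℕ}

/-- A linear map into `F` which lifts `f : ℂⁿ → F ⧸ U`. -/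
theorem exists_lift_quotient (U : Submodule ℂ F) (f : (Fin n → ℂ) →ₗ[ℂ] F ⧸ U) :
    ∃ J : (Fin n → ℂ) →L[ℂ] F, U.mkQ ∘ₗ J.toLinearMap = f := by
  obtain ⟨s, hs⟩ := U.mkQ.exists_rightInverse_of_surjective U.range_mkQ
  refine ⟨LinearMap.toContinuousLinearMap (s ∘ₗ f), ?_⟩
  ext1 i
  rw [LinearMap.coe_toContinuousLinearMap, ← LinearMap.comp_assoc, hs, LinearMap.id_comp]

theorem injective_coprod_iff {A : E →L[ℂ] F} (J : (Fin n → ℂ) →L[ℂ] F) (hA : Function.Injective A) :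
    Function.Injective (A.coprod J) ↔
      Function.Injective ((LinearMap.range A.toLinearMap).mkQ ∘ₗ J.toLinearMap) := by
  rw [injective_iff_map_eq_zero, injective_iff_map_eq_zero]
  constructor
  · intro h v hv
    obtain ⟨x, hx⟩ : J v ∈ LinearMap.range A.toLinearMap :=
      (Submodule.Quotient.mk_eq_zero _).1 hv
    have hx : A x = J v := hx
    exact congrArg Prod.snd (h (-x, v) (by simp [hx]))
  · rintro h ⟨x, v⟩ hxv
    have hxv : A x + J v = 0 := by simpa using hxv
    have hv : v = 0 := h v ((Submodule.Quotient.mk_eq_zero _).2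
      ⟨-x, by simpa using (neg_eq_of_add_eq_zero_right hxv)⟩)
    subst hv
    have hx : x = 0 := hA (by simpa using hxv)
    rw [hx, Prod.mk_zero_zero]

theorem surjective_coprod_iff {A : E →L[ℂ] F} (J : (Fin n → ℂ) →L[ℂ] F) :
    Function.Surjective (A.coprod J) ↔
      Function.Surjective ((LinearMap.range A.toLinearMap).mkQ ∘ₗ J.toLinearMap) := by
  constructor
  · intro h y
    obtain ⟨y, rfl⟩ := Submodule.mkQ_surjective _ y
    obtain ⟨⟨x, v⟩, rfl⟩ := h y
    refine ⟨v, (Submodule.Quotient.eq _).2 ⟨-x, ?_⟩⟩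
    simp
  · intro h y
    obtain ⟨v, hv⟩ := h (Submodule.Quotient.mk y)
    obtain ⟨x, hx⟩ := (Submodule.Quotient.eq _).1 hv
    have hx : A x = J v - y := hx
    exact ⟨(-x, v), by simp [hx]⟩

theorem continuous_coprod_left (J : (Fin n → ℂ) →L[ℂ] F) :
    Continuous fun A : E →L[ℂ] F => A.coprod J := by
  have : (fun A : E →L[ℂ] F => A.coprod J) = fun A =>
      A ∘L ContinuousLinearMap.fst ℂ E (Fin n → ℂ) +
        J ∘L ContinuousLinearMap.snd ℂ E (Fin n → ℂ) := by
    ext A x <;> simp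
  rw [this]
  fun_prop

variable [CompleteSpace E] [CompleteSpace F]

/-- The codimension of the range is lower semicontinuous on operators bounded below: if `J` maps
`ℂⁿ` injectively to `F` modulo `range A`, then `(A, J)` is bounded below, and so is `(B, J)` for `B`
near `A`. -/
theorem eventually_natCast_le_edim {A : E →L[ℂ] F} (hA : ∃ K, AntilipschitzWith K A)
    (h : (n : ℕ∞) ≤ edim (F ⧸ LinearMap.range A.toLinearMap)) :
    ∀ᶠ B in 𝓝 A, (n : ℕ∞) ≤ edim (F ⧸ LinearMap.range B.toLinearMap) := by
  obtain ⟨f, hf⟩ := natCast_le_edim.1 h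
  obtain ⟨J, rfl⟩ := exists_lift_quotient _ f
  have hinj : Function.Injective A := hA.choose_spec.injective
  have hcl : IsClosed (LinearMap.range A.toLinearMap : Set F) :=
    hA.choose_spec.isClosed_range A.uniformContinuous
  have hAJ : ∃ K, AntilipschitzWith K (A.coprod J) := by
    refine (A.coprod J).antilipschitz_of_injective_of_isClosed_range
      ((injective_coprod_iff J hinj).2 hf) ?_
    have := Submodule.isClosed_sup_finiteDimensional _ (LinearMap.range J.toLinearMap) hcl
    rw [← LinearMap.range_coprod] at this
    exact this
  filter_upwards [eventually_exists_antilipschitzWith hA,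
    (continuous_coprod_left J).tendsto A |>.eventually (eventually_exists_antilipschitzWith hAJ)]
    with B hB hBJ
  exact natCast_le_edim.2 ⟨_, (injective_coprod_iff J hB.choose_spec.injective).1
    hBJ.choose_spec.injective⟩

/-- A finite codimension of the range is locally constant on operators bounded below, since a
complement `J` of `range A` makes `(A, J)` invertible. -/
theorem eventually_edim_eq_natCast {A : E →L[ℂ] F} (hA : ∃ K, AntilipschitzWith K A)
    (h : edim (F ⧸ LinearMap.range A.toLinearMap) = n) :
    ∀ᶠ B in 𝓝 A, edim (F ⧸ LinearMap.range B.toLinearMap) = n := by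
  have hfin : FiniteDimensional ℂ (F ⧸ LinearMap.range A.toLinearMap) :=
    edim_lt_top.1 (h ▸ ENat.natCast_lt_top n)
  rw [edim_of_finiteDimensional, Nat.cast_inj] at h
  let f : (Fin n → ℂ) ≃ₗ[ℂ] F ⧸ LinearMap.range A.toLinearMap :=
    LinearEquiv.ofFinrankEq _ _ (by rw [h, Module.finrank_fin_fun])
  obtain ⟨J, hJ⟩ := exists_lift_quotient _ f.toLinearMap
  have hinj : Function.Injective A := hA.choose_spec.injective
  have hbij : Function.Bijective (A.coprod J) := by
    constructor
    · rw [injective_coprod_iff J hinj, hJ]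
      exact f.injective
    · rw [surjective_coprod_iff J, hJ]
      exact f.surjective
  let e : (E × (Fin n → ℂ)) ≃L[ℂ] F := ContinuousLinearEquiv.ofBijective (A.coprod J)
    (LinearMap.ker_eq_bot.2 hbij.1) (LinearMap.range_eq_top.2 hbij.2)
  have he : (e : (E × (Fin n → ℂ)) →L[ℂ] F) = A.coprod J :=
    ContinuousLinearEquiv.coe_ofBijective _ _ _
  have hnhds := e.nhds
  rw [he] at hnhds
  filter_upwards [eventually_exists_antilipschitzWith hA,
    (continuous_coprod_left J).tendsto A |>.eventually hnhds] with B hB hBJ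
  obtain ⟨e', he'⟩ := hBJ
  have hB' : Function.Bijective (B.coprod J) := by
    rw [← he']
    exact e'.bijective
  rw [← edim_congr (LinearEquiv.ofBijective _
    ⟨(injective_coprod_iff J hB.choose_spec.injective).1 hB'.1, (surjective_coprod_iff J).1 hB'.2⟩),
    edim_of_finiteDimensional, Module.finrank_fin_fun]

/-- Along a connected family of operators bounded below the codimension of the range is constant:
each finite value is attained on a clopen set, by `eventually_natCast_le_edim` and
`eventually_edim_eq_natCast`. -/
theorem edim_eq_of_preconnectedSpace {Λ : Type*} [TopologicalSpace Λ] [PreconnectedSpace Λ]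
    {A : Λ → E →L[ℂ] F} (hA : Continuous A) (h : ∀ s, ∃ K, AntilipschitzWith K (A s)) (s t : Λ) :
    edim (F ⧸ LinearMap.range (A s).toLinearMap) =
      edim (F ⧸ LinearMap.range (A t).toLinearMap) := by
  let c : Λ → ℕ∞ := fun s => edim (F ⧸ LinearMap.range (A s).toLinearMap)
  have key : ∀ (n : ℕ) (s : Λ), c s = n → ∀ t, c t = n := by
    intro n s hs
    have hcl : IsClopen {t | c t = n} := by
      refine ⟨⟨isOpen_iff_mem_nhds.2 fun t ht => ?_⟩, isOpen_iff_mem_nhds.2 fun t ht => ?_⟩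
      · have ht : c t ≠ n := ht
        obtain hlt | hgt := lt_or_gt_of_ne ht
        · obtain ⟨m, hm⟩ := ENat.ne_top_iff_exists.1 (ne_top_of_lt hlt)
          filter_upwards [hA.tendsto t |>.eventually
            (eventually_edim_eq_natCast (h t) (n := m) hm.symm)] with r hr
          have hr : c r = m := hr
          change c r ≠ n
          rwa [hr, hm]
        · have hle : ((n + 1 : ℕ) : ℕ∞) ≤ c t := by
            rw [Nat.cast_add, Nat.cast_one]
            exact Order.add_one_le_of_lt hgt
          filter_upwards [hA.tendsto t |>.eventually
            (eventually_natCast_le_edim (h t) hle)] with r hr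
          change c r ≠ n
          refine ne_of_gt (lt_of_lt_of_le ?_ hr)
          exact_mod_cast n.lt_succ_self
      · exact hA.tendsto t |>.eventually (eventually_edim_eq_natCast (h t) ht)
    intro t
    have := hcl.eq_univ ⟨s, hs⟩
    exact Set.eq_univ_iff_forall.1 this t
  change c s = c t
  obtain hs | hs := eq_or_ne (c s) ⊤
  · obtain ht | ht := eq_or_ne (c t) ⊤
    · rw [hs, ht]
    · obtain ⟨n, hn⟩ := ENat.ne_top_iff_exists.1 ht
      exact (key n t hn.symm s).trans hn
  · obtain ⟨n, hn⟩ := ENat.ne_top_iff_exists.1 hs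
    rw [← hn, key n s hn.symm t]

/-- An upper semi-Fredholm operator remains so, with the same index, after subtracting a small
scalar.  The index identity is written without subtraction. -/
theorem IsUpperSemiFredholm.eventually_sub_smul {S : E →L[ℂ] E} (hS : IsUpperSemiFredholm S) :
    ∀ᶠ c : ℂ in 𝓝 0, IsUpperSemiFredholm (S - c • 1) ∧
      kerDim (S - c • 1) + rangeCodim S = kerDim S + rangeCodim (S - c • 1) := by
  have hfin : FiniteDimensional ℂ (LinearMap.ker S.toLinearMap) := edim_lt_top.1 hS.2
  obtain ⟨Z, hZcl, hZ⟩ := (Submodule.ClosedComplemented.of_finiteDimensional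
    (LinearMap.ker S.toLinearMap)).exists_isClosed_isCompl
  have := hZcl.completeSpace_coe
  -- the restriction of `S - c` to `Z`, which is bounded below for `c = 0`
  let A : ℂ → Z →L[ℂ] E := fun c => (S - c • 1) ∘L Z.subtypeL
  have hA : Continuous A := by
    fun_prop
  have hrange : ∀ c, LinearMap.range (A c).toLinearMap = Z.map (S - c • 1).toLinearMap := by
    intro c
    change LinearMap.range ((S - c • 1).toLinearMap ∘ₗ Z.subtype) = _
    rw [LinearMap.range_comp, Submodule.range_subtype]
  have hAcl : IsClosed (Set.range (A 0)) := by
    have : Set.range (A 0) = Set.range S := by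
      ext y
      constructor
      · rintro ⟨z, rfl⟩
        exact ⟨z, by simp [A]⟩
      · rintro ⟨x, rfl⟩
        have hx : x ∈ LinearMap.ker S.toLinearMap ⊔ Z := by rw [hZ.sup_eq_top]; trivial
        obtain ⟨k, hk, z, hz, rfl⟩ := Submodule.mem_sup.1 hx
        have hk : S k = 0 := hk
        exact ⟨⟨z, hz⟩, by simp [A, hk]⟩
    rw [this]
    exact hS.1
  have hAinj : Function.Injective (A 0) := by
    rw [injective_iff_map_eq_zero]
    intro z hz
    exact Subtype.ext (Submodule.disjoint_def.1 hZ.disjoint z (by simpa [A] using hz) z.2)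
  have hbd : ∀ᶠ c in 𝓝 (0 : ℂ), ∃ K, AntilipschitzWith K (A c) := hA.tendsto 0 |>.eventually
    (eventually_exists_antilipschitzWith
      ((A 0).antilipschitz_of_injective_of_isClosed_range hAinj hAcl))
  obtain ⟨ε, hε, hball⟩ := Metric.eventually_nhds_iff_ball.1 hbd
  have hquot : edim (E ⧸ Z) = kerDim S := edim_congr (Submodule.quotientEquivOfIsCompl _ _ hZ.symm)
  have hquotfin : FiniteDimensional ℂ (E ⧸ Z) := edim_lt_top.1 (hquot ▸ hS.2)
  -- compare the kernel and the cokernel of `S - c` with the codimension of `(S - c) Z`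
  have hdisj : ∀ c ∈ Metric.ball (0 : ℂ) ε, Disjoint (LinearMap.ker (S - c • 1).toLinearMap) Z := by
    intro c hc
    rw [Submodule.disjoint_def]
    intro x hx hxZ
    have hinj : Function.Injective (A c) := (hball c hc).choose_spec.injective
    have hx : (S - c • 1) x = 0 := hx
    have : (⟨x, hxZ⟩ : Z) = 0 := hinj (by rw [map_zero]; exact hx)
    exact congrArg Subtype.val this
  have hindex : ∀ c ∈ Metric.ball (0 : ℂ) ε,
      kerDim (S - c • 1) + edim (E ⧸ LinearMap.range (A c).toLinearMap) =
        kerDim S + rangeCodim (S - c • 1) := by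
    intro c hc
    rw [hrange, ← hquot]
    exact edim_ker_add_edim_quotient_map _ Z (hdisj c hc)
  have h0 : (0 : ℂ) ∈ Metric.ball (0 : ℂ) ε := Metric.mem_ball_self hε
  have hcodim0 : edim (E ⧸ LinearMap.range (A 0).toLinearMap) = rangeCodim S := by
    have := hindex 0 h0
    rw [zero_smul, sub_zero] at this
    exact ENat.add_right_injective_of_ne_top hS.2.ne this
  filter_upwards [Metric.ball_mem_nhds 0 hε] with c hc
  refine ⟨⟨?_, ?_⟩, ?_⟩
  · have hcl : IsClosed (Z.map (S - c • 1).toLinearMap : Set E) := by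
      rw [← hrange]
      exact (hball c hc).choose_spec.isClosed_range (A c).uniformContinuous
    have : Z.CoFG := hquotfin
    exact LinearMap.isClosed_range_of_isClosed_map_of_finiteDimensional_quotient hcl
  · refine lt_of_le_of_lt ?_ (hquot ▸ hS.2)
    refine edim_le_of_injective (Z.mkQ.domRestrict (LinearMap.ker (S - c • 1).toLinearMap)) ?_
    rw [injective_iff_map_eq_zero]
    intro x hx
    exact Subtype.ext (Submodule.disjoint_def.1 (hdisj c hc) x x.2
      ((Submodule.Quotient.mk_eq_zero _).1 hx))
  · have hconn : PreconnectedSpace (Metric.ball (0 : ℂ) ε) :=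
      Subtype.preconnectedSpace (convex_ball (0 : ℂ) ε).isPreconnected
    have := edim_eq_of_preconnectedSpace (A := fun c : Metric.ball (0 : ℂ) ε => A c)
      (hA.comp continuous_subtype_val) (fun c => hball c c.2) ⟨c, hc⟩ ⟨0, h0⟩
    rw [← hindex c hc, ← hcodim0]
    exact congrArg _ this.symm

end stability

/-! ### Independence of the index -/

section index

open Filter Topology

variable {X : Type*} [NormedAddCommGroup X] [NormedSpace ℂ X]

theorem coe_sub_coe_eq {a b a' b' : ℕ∞} (ha : a < ⊤) (ha' : a' < ⊤) (h : a' + b = a + b') :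
    ((a : ℝ≥0∞) : EReal) - ((b : ℝ≥0∞) : EReal) =
      ((a' : ℝ≥0∞) : EReal) - ((b' : ℝ≥0∞) : EReal) := by
  lift a to ℕ using ha.ne
  lift a' to ℕ using ha'.ne
  obtain rfl | hb := eq_or_ne b ⊤
  · have hb' : b' = ⊤ := by simpa using h.symm
    subst hb'
    simp
  · have hb' : b' ≠ ⊤ := by
      rintro rfl
      lift b to ℕ using hb
      rw [add_top] at h
      exact ENat.natCast_ne_top (a' + b) (by exact_mod_cast h)
    lift b to ℕ using hb
    lift b' to ℕ using hb'
    have h : a' + b = a + b' := by exact_mod_cast h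
    have h : (a' : ℝ) + b = a + b' := by exact_mod_cast h
    have hcast : ∀ n : ℕ, (((n : ℕ∞) : ℝ≥0∞) : EReal) = ((n : ℝ) : EReal) := fun n => by
      rw [ENat.toENNReal_coe, ← ENNReal.coe_natCast]
      rfl
    rw [hcast, hcast, hcast, hcast, ← EReal.coe_sub, ← EReal.coe_sub, EReal.coe_eq_coe_iff]
    linarith

theorem neg_coe_sub_coe {a b : ℕ∞} (h : a < ⊤ ∨ b < ⊤) :
    -(((a : ℝ≥0∞) : EReal) - ((b : ℝ≥0∞) : EReal)) =
      ((b : ℝ≥0∞) : EReal) - ((a : ℝ≥0∞) : EReal) := by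
  have key : ∀ {c : ℕ∞}, c < ⊤ → ((c : ℝ≥0∞) : EReal) ≠ ⊤ := fun {c} hc => by
    lift c to ℕ using hc.ne
    simp
  rw [EReal.neg_sub, add_comm, sub_eq_add_neg]
  · exact Or.inl (EReal.coe_ennreal_ne_bot _)
  · exact h.imp key key

theorem semiFredholmIndex_congr {Y : Type*} [NormedAddCommGroup Y] [NormedSpace ℂ Y]
    {S : X →L[ℂ] X} {R : Y →L[ℂ] Y} (hk : kerDim S = kerDim R) (hr : rangeCodim S = rangeCodim R) :
    semiFredholmIndex S = semiFredholmIndex R := by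
  rw [semiFredholmIndex, semiFredholmIndex, hk, hr]

variable [CompleteSpace X]

theorem IsSemiFredholm.isClosed_range {S : X →L[ℂ] X} (hS : IsSemiFredholm S) :
    IsClosed (Set.range S) :=
  hS.elim (fun h => h.1) isClosed_range_of_rangeCodim_lt_top

set_option synthInstance.maxHeartbeats 100000 in
theorem IsUpperSemiFredholm.semiFredholmIndex_adjoint {S : X →L[ℂ] X} (hS : IsUpperSemiFredholm S) :
    semiFredholmIndex (adjoint S) = -semiFredholmIndex S := by
  rw [semiFredholmIndex, semiFredholmIndex, kerDim_adjoint hS.1, rangeCodim_adjoint hS.1,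
    neg_coe_sub_coe (Or.inl hS.2)]

namespace Red

variable {T : X →L[ℂ] X}

theorem semiFredholmIndex_dual_onM (d : Red T) (h : IsSemiFredholm d.onM) :
    semiFredholmIndex d.dual.onM = -semiFredholmIndex d.onM := by
  rw [semiFredholmIndex, semiFredholmIndex, d.kerDim_dual_onM h.isClosed_range,
    d.rangeCodim_dual_onM h.isClosed_range]
  exact (neg_coe_sub_coe (h.imp (fun h => h.2) id)).symm

theorem isUpperSemiFredholm_dual_onM (d : Red T) (h : IsLowerSemiFredholm d.onM) :
    IsUpperSemiFredholm d.dual.onM := by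
  have hcl := isClosed_range_of_rangeCodim_lt_top h
  exact ⟨d.isClosed_range_dual_onM hcl, (d.kerDim_dual_onM hcl).trans_lt h⟩

theorem isLowerSemiFredholm_dual_onM (d : Red T) (h : IsUpperSemiFredholm d.onM) :
    IsLowerSemiFredholm d.dual.onM :=
  (d.rangeCodim_dual_onM h.1).trans_lt h.2

theorem IsSemiFredholmQuasiNilpotent.dual {d : Red T} (h : d.IsSemiFredholmQuasiNilpotent) :
    d.dual.IsSemiFredholmQuasiNilpotent :=
  ⟨h.1.elim (fun h => Or.inr (d.isLowerSemiFredholm_dual_onM h))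
    (fun h => Or.inl (d.isUpperSemiFredholm_dual_onM h)), d.isQuasiNilpotent_dual_onN h.2⟩

/-- For small `c ≠ 0` the operator `T - c` is the direct sum of a perturbation of `T_M` and of an
invertible operator. -/
theorem eventually_semiFredholmIndex_sub_smul (d : Red T) (hM : IsUpperSemiFredholm d.onM)
    (hN : IsQuasiNilpotent d.onN) :
    ∀ᶠ c : ℂ in 𝓝[≠] 0, IsUpperSemiFredholm (T - c • 1) ∧
      semiFredholmIndex (T - c • 1) = semiFredholmIndex d.onM := by
  filter_upwards [hM.eventually_sub_smul.filter_mono nhdsWithin_le_nhds, self_mem_nhdsWithin]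
    with c hc hc0
  have hbij : Function.Bijective (d.shift c).onN := by
    have hu : IsUnit (algebraMap ℂ (d.N →L[ℂ] d.N) c - d.onN) := by
      by_contra h
      exact hc0 (hN h)
    rw [← IsUnit.neg_iff, neg_sub, Algebra.algebraMap_eq_smul_one] at hu
    exact ContinuousLinearMap.isUnit_iff_bijective.1 hu
  rw [← d.shift_onM] at hc
  refine ⟨⟨(d.shift c).isClosed_range_of_bijective hbij hc.1.1,
    ((d.shift c).kerDim_eq_of_bijective hbij).trans_lt hc.1.2⟩, ?_⟩
  rw [semiFredholmIndex_congr ((d.shift c).kerDim_eq_of_bijective hbij)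
    ((d.shift c).rangeCodim_eq_of_bijective hbij)]
  exact (coe_sub_coe_eq hM.2 hc.1.2 hc.2).symm

theorem semiFredholmIndex_onM_eq_of_upper {d d' : Red T} (h : d.IsSemiFredholmQuasiNilpotent)
    (h' : d'.IsSemiFredholmQuasiNilpotent) (hM : IsUpperSemiFredholm d.onM)
    (hM' : IsUpperSemiFredholm d'.onM) :
    semiFredholmIndex d.onM = semiFredholmIndex d'.onM := by
  obtain ⟨c, hc, hc'⟩ := ((d.eventually_semiFredholmIndex_sub_smul hM h.2).and
    (d'.eventually_semiFredholmIndex_sub_smul hM' h'.2)).exists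
  rw [← hc.2, ← hc'.2]

set_option synthInstance.maxHeartbeats 100000 in
/-- Here `T - c` and its adjoint are both upper semi-Fredholm for small `c ≠ 0`. -/
theorem semiFredholmIndex_onM_eq_of_upper_of_lower {d d' : Red T}
    (h : d.IsSemiFredholmQuasiNilpotent) (h' : d'.IsSemiFredholmQuasiNilpotent)
    (hM : IsUpperSemiFredholm d.onM) (hM' : IsLowerSemiFredholm d'.onM) :
    semiFredholmIndex d.onM = semiFredholmIndex d'.onM := by
  obtain ⟨c, hc, hc'⟩ := ((d.eventually_semiFredholmIndex_sub_smul hM h.2).and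
    (d'.dual.eventually_semiFredholmIndex_sub_smul (d'.isUpperSemiFredholm_dual_onM hM')
      h'.dual.2)).exists
  have hadj := hc.1.semiFredholmIndex_adjoint
  rw [adjoint_sub_smul_one, hc'.2, hc.2, d'.semiFredholmIndex_dual_onM h'.1] at hadj
  exact (neg_injective hadj).symm

theorem semiFredholmIndex_onM_eq {d d' : Red T} (h : d.IsSemiFredholmQuasiNilpotent)
    (h' : d'.IsSemiFredholmQuasiNilpotent) :
    semiFredholmIndex d.onM = semiFredholmIndex d'.onM := by
  rcases h.1 with hM | hM <;> rcases h'.1 with hM' | hM'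
  · exact semiFredholmIndex_onM_eq_of_upper h h' hM hM'
  · exact semiFredholmIndex_onM_eq_of_upper_of_lower h h' hM hM'
  · exact (semiFredholmIndex_onM_eq_of_upper_of_lower h' h hM' hM).symm
  · have := semiFredholmIndex_onM_eq_of_upper h.dual h'.dual (d.isUpperSemiFredholm_dual_onM hM)
      (d'.isUpperSemiFredholm_dual_onM hM')
    rw [d.semiFredholmIndex_dual_onM h.1, d'.semiFredholmIndex_dual_onM h'.1] at this
    exact neg_injective this

end Red

end index

end PseudoFredholm

end

/-- The first two conjuncts say that the invariants do not depend on the decomposition from which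
they are computed; the last two are the duality statements. -/
theorem mainTheorem2 {X : Type*} [NormedAddCommGroup X] [NormedSpace ℂ X] [CompleteSpace X]
    (T : X →L[ℂ] X) :
    (∀ (hT : PseudoFredholm.IsPseudoFredholm T) (d : PseudoFredholm.Red T), d.IsGKD →
      PseudoFredholm.kerDim d.onM = PseudoFredholm.nullity T hT ∧
      PseudoFredholm.rangeCodim d.onM = PseudoFredholm.deficiency T hT ∧
      PseudoFredholm.operatorAscent d.onM = PseudoFredholm.ascent T hT ∧
      PseudoFredholm.operatorDescent d.onM = PseudoFredholm.descent T hT) ∧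
    (∀ (hT : PseudoFredholm.IsPseudoSemiBFredholm T) (d : PseudoFredholm.Red T),
      d.IsSemiFredholmQuasiNilpotent →
      PseudoFredholm.semiFredholmIndex d.onM = PseudoFredholm.index T hT) ∧
    (∀ hT : PseudoFredholm.IsPseudoFredholm T,
      ∃ hT' : PseudoFredholm.IsPseudoFredholm (PseudoFredholm.adjoint T),
        PseudoFredholm.nullity T hT =
          PseudoFredholm.deficiency (PseudoFredholm.adjoint T) hT' ∧
        PseudoFredholm.deficiency T hT =
          PseudoFredholm.nullity (PseudoFredholm.adjoint T) hT' ∧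
        PseudoFredholm.ascent T hT =
          PseudoFredholm.descent (PseudoFredholm.adjoint T) hT' ∧
        PseudoFredholm.descent T hT =
          PseudoFredholm.ascent (PseudoFredholm.adjoint T) hT') ∧
    (∀ hT : PseudoFredholm.IsPseudoSemiBFredholm T,
      ∃ hT' : PseudoFredholm.IsPseudoSemiBFredholm (PseudoFredholm.adjoint T),
        PseudoFredholm.index T hT =
          -PseudoFredholm.index (PseudoFredholm.adjoint T) hT') := by
  refine ⟨fun hT d hd => ?_, fun hT d hd =>
    PseudoFredholm.Red.semiFredholmIndex_onM_eq hd hT.choose_spec, fun hT => ?_, fun hT => ?_⟩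
  · have hα := PseudoFredholm.Red.kerDim_onM_eq hd hT.choose_spec
    have hβ := PseudoFredholm.Red.rangeCodim_onM_eq hd hT.choose_spec
    refine ⟨hα, hβ, ?_, ?_⟩
    · rw [PseudoFredholm.ascent, hd.1.operatorAscent_eq, hT.choose_spec.1.operatorAscent_eq, hα]
    · rw [PseudoFredholm.descent, hd.1.operatorDescent_eq, hT.choose_spec.1.operatorDescent_eq, hβ]
  · have hd := hT.choose_spec
    have hT' : PseudoFredholm.IsPseudoFredholm (PseudoFredholm.adjoint T) := ⟨_, hd.dual⟩
    have hα := (PseudoFredholm.Red.rangeCodim_dual_onM _ hd.1.1).symm.trans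
      (PseudoFredholm.Red.rangeCodim_onM_eq hd.dual hT'.choose_spec)
    have hβ := (PseudoFredholm.Red.kerDim_dual_onM _ hd.1.1).symm.trans
      (PseudoFredholm.Red.kerDim_onM_eq hd.dual hT'.choose_spec)
    refine ⟨hT', hα, hβ, ?_, ?_⟩
    · rw [PseudoFredholm.ascent, PseudoFredholm.descent, hd.1.operatorAscent_eq,
        hT'.choose_spec.1.operatorDescent_eq, hα]
    · rw [PseudoFredholm.ascent, PseudoFredholm.descent, hd.1.operatorDescent_eq,
        hT'.choose_spec.1.operatorAscent_eq, hβ]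
  · have hd := hT.choose_spec
    have hT' : PseudoFredholm.IsPseudoSemiBFredholm (PseudoFredholm.adjoint T) := ⟨_, hd.dual⟩
    refine ⟨hT', ?_⟩
    have h := PseudoFredholm.Red.semiFredholmIndex_onM_eq hd.dual hT'.choose_spec
    rw [PseudoFredholm.Red.semiFredholmIndex_dual_onM _ hd.1] at h
    rw [PseudoFredholm.index, PseudoFredholm.index, ← h, neg_neg]
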